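/- Let $d \ge 2$ and let $n,h$ be integers with $1 \le h \le n/2$. Write $|1\rangle,|2\rangle,\dots,|d\rangle$ for the standard basis of $\mathbb{C}^d$. A tester receives $n$ registers, each of local dimension $d$. With probability $p=\tfrac12$ each, their joint state is $U^{\otimes n}|1^n\rangle$ ("equal") or $U^{\otimes n}|1^{n-h}2^{h}\rangle$ ("not equal", with promise $\mu=(n-h,h)$), where $U\in \mathbb{U}(d)$ is an unknown unitary. For a Borel probability measure $q$ on $\mathbb{U}(d)$ put $$\rho_{=}^{(q)}=\int U^{\otimes n}|1^n\rangle\langle 1^n|(U^\dagger)^{\otimes n}\,dq(U),\qquad \rho_{\neq}^{(q)}=\int U^{\otimes n}|1^{n-h}2^h\rangle\langle 1^{n-h}2^h|(U^\dagger)^{\otimes n}\,dq(U).$$ For a measurement (two-outcome POVM) $\{\Pi_{=},\Pi_{\neq}\}$ on $(\mathbb{C}^d)^{\otimes n}$, i.e. $\Pi_=\succeq 0$, $\Pi_{\neq}\succeq 0$, $\Pi_{=}+\Pi_{\neq}=\mathbb{1}$, its completeness, soundness and average success probability are $$\mathbb{P}_c^{(q)}=\mathrm{Tr}[\Pi_{=}\rho_{=}^{(q)}],\qquad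 \mathbb{P}_s^{(q)}=\mathrm{Tr}[\Pi_{\neq}\rho_{\neq}^{(q)}],\qquad \mathbb{P}_{succ}^{(q)}=\tfrac12\mathbb{P}_c^{(q)}+\tfrac12\mathbb{P}_s^{(q)}.$$ The permutation test is $\Pi_{=}=\Pi_{(n)}$, $\Pi_{\neq}=\mathbb{1}-\Pi_{(n)}$, where $\Pi_{(n)}=\frac1{n!}\sum_{\pi\in S_n}\psi(\pi)$ is the projector onto the symmetric subspace and $\psi(\pi)$ permutes the $n$ registers. Theorem. The permutation test is a measurement, and it is optimal among all measurements, with no restriction on either type of error: it maximizes $\mathbb{P}_{succ}^{(q)}$ for Haar-distributed $U$ ($q$ the Haar probability measure), and it also maximizes the worst-case value $\inf_q \mathbb{P}_{succ}^{(q)}$ over all Borel probability measures $q$ on $\mathbb{U}(d)$. For the Haar measure, and indeed for every $q$, the permutation test has $$\mathbb{P}_{succ}^{(q)}=1-\frac{1}{2\binom nh},\qquad \mathbb{P}_c^{(q)}=1,\qquad \mathbb{P}_s^{(q)}=1-\frac{1}{\binom nh}.$$ -/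

import Mathlib

namespace QSI

open MeasureTheory Matrix
open scoped ComplexOrder

/-- The unitary group `U(d)`. -/
abbrev Unitaries (d : ℕ) : Type := Matrix.unitaryGroup (Fin d) ℂ

/-- Operators on `(ℂ^d)^{⊗ n}`, written as matrices in the computational basis `|a₁ a₂ … aₙ⟩`,
which is indexed by the words `a : Fin n → Fin d`. -/
abbrev Op (n d : ℕ) : Type := Matrix (Fin n → Fin d) (Fin n → Fin d) ℂ

/-! ### The Haar probability measure on the unitary group -/

noncomputable instance instMeasurableSpaceUnitaries (d : ℕ) : MeasurableSpace (Unitaries d) :=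
  borel (Unitaries d)

instance instBorelSpaceUnitaries (d : ℕ) : BorelSpace (Unitaries d) := ⟨rfl⟩

instance instCompactSpaceUnitaries (d : ℕ) : CompactSpace (Unitaries d) := by
  have hsub : (Matrix.unitaryGroup (Fin d) ℂ : Set (Matrix (Fin d) (Fin d) ℂ)) ⊆
      Set.pi Set.univ (fun _ => Set.pi Set.univ (fun _ => Metric.closedBall (0 : ℂ) 1)) := by
    intro U hU i _ j _
    simpa using entry_norm_bound_of_unitary hU i j
  have hc : IsCompact (Set.pi Set.univ
      (fun _ : Fin d => Set.pi Set.univ (fun _ : Fin d => Metric.closedBall (0 : ℂ) 1))) :=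
    isCompact_univ_pi fun _ => isCompact_univ_pi fun _ => isCompact_closedBall 0 1
  exact isCompact_iff_compactSpace.mp
    (hc.of_isClosed_subset (isClosed_unitary (R := Matrix (Fin d) (Fin d) ℂ)) hsub)

/-- The Haar probability measure on `U(d)`: the Haar measure that gives the whole (compact) group
mass one. -/
noncomputable def haar (d : ℕ) : ProbabilityMeasure (Unitaries d) :=
  ⟨Measure.haarMeasure (⊤ : TopologicalSpace.PositiveCompacts (Unitaries d)), ⟨by
    simpa using Measure.haarMeasure_self (K₀ := (⊤ : TopologicalSpace.PositiveCompacts (Unitaries d)))⟩⟩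

/-! ### Tensor powers, input words and ensemble states -/

/-- The tensor power `U^{⊗ n}`, with entries `⟨a| U^{⊗ n} |b⟩ = ∏ i, U (a i) (b i)`. -/
def tensorPower (n : ℕ) {d : ℕ} (U : Matrix (Fin d) (Fin d) ℂ) : Op n d :=
  Matrix.of fun a b => ∏ i, U (a i) (b i)

/-- The rank-one projector `|w⟩⟨w|` onto a computational basis state. -/
def basisProj {n d : ℕ} (w : Fin n → Fin d) : Op n d :=
  Matrix.single w w 1

/-- The word of the basis state `|1^n⟩`. The first basis state `|1⟩` of `ℂ^d` is indexed
by `0 : Fin d`, the second basis state `|2⟩` by `1 : Fin d`. -/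
def equalWord (n d : ℕ) (hd : 2 ≤ d) : Fin n → Fin d :=
  fun _ => ⟨0, by omega⟩

/-- The word of the basis state `|1^{n-h} 2^h⟩`. -/
def unequalWord (n h d : ℕ) (hd : 2 ≤ d) : Fin n → Fin d :=
  fun i => if (i : ℕ) < n - h then ⟨0, by omega⟩ else ⟨1, by omega⟩

/-- The state `∫ U^{⊗ n} |w⟩⟨w| (U†)^{⊗ n} dq(U)` for a Borel probability measure `q` on `U(d)`;
the integral of the matrix-valued function is taken entry by entry. -/
noncomputable def ensembleState {n d : ℕ} (q : ProbabilityMeasure (Unitaries d))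
    (w : Fin n → Fin d) : Op n d :=
  Matrix.of fun a b =>
    ∫ U, (tensorPower n (U : Matrix (Fin d) (Fin d) ℂ) * basisProj w *
      (tensorPower n (U : Matrix (Fin d) (Fin d) ℂ))ᴴ) a b ∂(q : Measure (Unitaries d))

/-! ### Measurements and their success probabilities -/

/-- `{E, F}` is a two-outcome measurement (POVM) on `(ℂ^d)^{⊗ n}`. The outcome of `E` is read as
the answer `equal`, the outcome of `F` as the answer `not equal`. -/
structure IsPOVM {n d : ℕ} (E F : Op n d) : Prop where
  posSemidef_equal : E.PosSemidef
  posSemidef_unequal : F.PosSemidef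
  sum_eq_one : E + F = 1

/-- Completeness: the probability `Tr[E ρ_=]` of the answer `equal` on equal inputs. (The trace is
real for a POVM element `E`.) -/
noncomputable def completeness {n d : ℕ} (hd : 2 ≤ d) (q : ProbabilityMeasure (Unitaries d))
    (E : Op n d) : ℝ :=
  (Matrix.trace (E * ensembleState q (equalWord n d hd))).re

/-- Soundness: the probability `Tr[F ρ_≠]` of the answer `not equal` on inputs that are unequal
with `μ = (n - h, h)`. (The trace is real for a POVM element `F`.) -/
noncomputable def soundness {n d : ℕ} (hd : 2 ≤ d) (h : ℕ) (q : ProbabilityMeasure (Unitaries d))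
    (F : Op n d) : ℝ :=
  (Matrix.trace (F * ensembleState q (unequalWord n h d hd))).re

/-- Average success probability of the measurement `{E, F}` when the inputs are equal with
probability `p` and unequal with probability `1 - p`. -/
noncomputable def avgSuccess {n d : ℕ} (hd : 2 ≤ d) (h : ℕ) (p : ℝ)
    (q : ProbabilityMeasure (Unitaries d)) (E F : Op n d) : ℝ :=
  p * completeness hd q E + (1 - p) * soundness hd h q F

/-- Average success probability that the measurement `{E, F}` guarantees when an adversary chooses
the distribution of the unknown unitary. -/
noncomputable def worstCaseSuccess {n d : ℕ} (hd : 2 ≤ d) (h : ℕ) (p : ℝ) (E F : Op n d) : ℝ :=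
  ⨅ q : ProbabilityMeasure (Unitaries d), avgSuccess hd h p q E F

/-! ### The permutation test -/

/-- The operator `ψ(π)` that permutes the `n` registers: it sends `|b⟩` to `|b ∘ π⁻¹⟩`. -/
def permOp {n : ℕ} (d : ℕ) (π : Equiv.Perm (Fin n)) : Op n d :=
  Matrix.of fun a b => if a = b ∘ (π⁻¹ : Equiv.Perm (Fin n)) then 1 else 0

/-- `Π_{(n)} = (1 / n!) ∑_π ψ(π)`, the projector onto the symmetric subspace: the `equal` outcome
of the permutation test. -/
noncomputable def symProj (n d : ℕ) : Op n d :=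
  ((n.factorial : ℂ)⁻¹) • ∑ π : Equiv.Perm (Fin n), permOp d π

end QSI

/-! Optimality rests on the operator inequality A ≥ P / C for the Haar-averaged unequal state A and
equal state P, with C = `n.choose h` (`posSemidef_ensembleState_haar_sub`). Pairing it with E gives
soundness ≤ 1 - completeness / C. Since completeness ≤ 1 and C ≥ 1, the average is at most 1 -
1/(2C).

No representation theory is needed for the inequality. Put e = 1^n and w = 1^{n-h}2^h. An operator
commuting with every U^{⊗n} preserves letter counts, so |e⟩ is an eigenvector of it, and so is every
U^{⊗n}|e⟩, with the same eigenvalue. Hence P P = P_ee P and A P = A_ee P: P / P_ee is a projection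
commuting with A, and compressing A to its complement gives A - (A_ee / P_ee) P ≥ 0. The ratio is
1/C by A_ee = P_ww and `choose_mul_ensembleState_haar`.

The symmetric projector commutes with every U^{⊗n}, so its success probabilities are its diagonal
entries at e and w, whatever q is. Its worst case therefore equals its Haar value, while the worst
case of any other measurement is at most its own Haar value. -/

namespace QSI

open MeasureTheory Matrix
open scoped ComplexOrder

/-! ### Tensor powers -/

section TensorPower

variable {n d : ℕ}

lemma tensorPower_mul (U V : Matrix (Fin d) (Fin d) ℂ) :
    tensorPower n (U * V) = tensorPower n U * tensorPower n V := by
  ext a b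
  simp only [tensorPower, Matrix.of_apply, Matrix.mul_apply, ← Finset.prod_mul_distrib]
  rw [Finset.prod_univ_sum, Fintype.piFinset_univ]

lemma tensorPower_diagonal (z : Fin d → ℂ) :
    tensorPower n (Matrix.diagonal z) = Matrix.diagonal fun a => ∏ i, z (a i) := by
  ext a b
  by_cases hab : a = b
  · subst hab
    simp [tensorPower]
  · obtain ⟨i, hi⟩ := Function.ne_iff.mp hab
    rw [Matrix.diagonal_apply_ne _ hab]
    exact Finset.prod_eq_zero (Finset.mem_univ i) (Matrix.diagonal_apply_ne _ hi)

lemma tensorPower_one : tensorPower n (1 : Matrix (Fin d) (Fin d) ℂ) = 1 := by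
  simpa using tensorPower_diagonal (n := n) (d := d) 1

lemma tensorPower_conjTranspose (U : Matrix (Fin d) (Fin d) ℂ) :
    tensorPower n Uᴴ = (tensorPower n U)ᴴ := by
  ext a b
  simp [tensorPower]

lemma tensorPower_unitary_conjTranspose_mul (U : Unitaries d) :
    (tensorPower n (U : Matrix (Fin d) (Fin d) ℂ))ᴴ * tensorPower n U = 1 := by
  rw [← tensorPower_conjTranspose, ← tensorPower_mul, ← Matrix.star_eq_conjTranspose,
    Unitary.coe_star_mul_self, tensorPower_one]

lemma continuous_tensorPower_apply (a b : Fin n → Fin d) :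
    Continuous fun U : Unitaries d => tensorPower n (U : Matrix (Fin d) (Fin d) ℂ) a b := by
  simp only [tensorPower, Matrix.of_apply]
  exact continuous_finsetProd _ fun i _ =>
    (continuous_subtype_val.matrix_elem (a i) (b i))

/-- The pure state `U^{⊗ n} |w⟩⟨w| (U†)^{⊗ n}`. -/
noncomputable def pureState (w : Fin n → Fin d) (U : Unitaries d) : Op n d :=
  tensorPower n (U : Matrix (Fin d) (Fin d) ℂ) * basisProj w *
    (tensorPower n (U : Matrix (Fin d) (Fin d) ℂ))ᴴ

lemma mul_basisProj_apply (B : Op n d) (w a b : Fin n → Fin d) :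
    (B * basisProj w) a b = if b = w then B a w else 0 := by
  simp [basisProj, Matrix.mul_apply, Matrix.single_apply, ite_and, eq_comm]

lemma pureState_apply (w : Fin n → Fin d) (U : Unitaries d) (a b : Fin n → Fin d) :
    pureState w U a b =
      tensorPower n (U : Matrix (Fin d) (Fin d) ℂ) a w *
        star (tensorPower n (U : Matrix (Fin d) (Fin d) ℂ) b w) := by
  rw [pureState, Matrix.mul_apply]
  simp [mul_basisProj_apply]

lemma posSemidef_basisProj (w : Fin n → Fin d) : (basisProj w).PosSemidef := by
  have : basisProj w = (basisProj w)ᴴ * basisProj w := by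
    simp [basisProj]
  rw [this]
  exact posSemidef_conjTranspose_mul_self _

lemma posSemidef_pureState (w : Fin n → Fin d) (U : Unitaries d) :
    (pureState w U).PosSemidef :=
  (posSemidef_basisProj w).mul_mul_conjTranspose_same _

lemma trace_mul_basisProj (B : Op n d) (w : Fin n → Fin d) :
    (B * basisProj w).trace = B w w := by
  simp [basisProj, Matrix.trace_mul_single]

lemma continuous_pureState (w : Fin n → Fin d) : Continuous (pureState w) := by
  refine continuous_matrix fun a b => ?_
  simp only [pureState_apply]
  exact (continuous_tensorPower_apply a w).mul (continuous_tensorPower_apply b w).star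

end TensorPower

/-! ### Ensemble states -/

section Ensemble

variable {n d : ℕ}

lemma ensembleState_apply (q : ProbabilityMeasure (Unitaries d)) (w a b : Fin n → Fin d) :
    ensembleState q w a b = ∫ U, pureState w U a b ∂(q : Measure (Unitaries d)) := rfl

lemma integrable_of_continuous (q : ProbabilityMeasure (Unitaries d)) {f : Unitaries d → ℂ}
    (hf : Continuous f) : Integrable f (q : Measure (Unitaries d)) :=
  hf.integrable_of_hasCompactSupport (HasCompactSupport.of_compactSpace f)

lemma mul_ensembleState_mul_apply (q : ProbabilityMeasure (Unitaries d)) (w : Fin n → Fin d)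
    (M N : Op n d) (a b : Fin n → Fin d) :
    (M * ensembleState q w * N) a b =
      ∫ U, (M * pureState w U * N) a b ∂(q : Measure (Unitaries d)) := by
  simp only [Matrix.mul_apply, ensembleState_apply, Finset.sum_mul]
  have hc : ∀ c e : Fin n → Fin d,
      Integrable (fun U => M a e * pureState w U e c * N c b) (q : Measure (Unitaries d)) :=
    fun c e => integrable_of_continuous q (by
      have := (continuous_pureState (n := n) w).matrix_elem e c
      fun_prop)
  rw [integral_finsetSum _ fun c _ => integrable_finsetSum _ fun e _ => hc c e]
  refine Finset.sum_congr rfl fun c _ => ?_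
  rw [integral_finsetSum _ fun e _ => hc c e]
  refine Finset.sum_congr rfl fun e _ => ?_
  rw [integral_mul_const, integral_const_mul]

lemma trace_mul_ensembleState (q : ProbabilityMeasure (Unitaries d)) (w : Fin n → Fin d)
    (B : Op n d) :
    (B * ensembleState q w).trace =
      ∫ U, (B * pureState w U).trace ∂(q : Measure (Unitaries d)) := by
  have hB : ∀ a, (B * ensembleState q w) a a =
      ∫ U, (B * pureState w U) a a ∂(q : Measure (Unitaries d)) := fun a => by
    simpa using mul_ensembleState_mul_apply q w B 1 a a
  simp only [Matrix.trace, Matrix.diag_apply, hB]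
  refine (integral_finsetSum _ fun a _ => integrable_of_continuous q ?_).symm
  exact (continuous_const.matrix_mul (continuous_pureState w)).matrix_elem a a

/-- `B` commutes with all tensor powers `U^{⊗ n}` of unitaries. -/
def IsInvariant (B : Op n d) : Prop :=
  ∀ U : Unitaries d, tensorPower n (U : Matrix (Fin d) (Fin d) ℂ) * B =
    B * tensorPower n (U : Matrix (Fin d) (Fin d) ℂ)

lemma IsInvariant.one_sub {B : Op n d} (hB : IsInvariant B) : IsInvariant (1 - B) := fun U => by
  rw [mul_sub, sub_mul, hB U, one_mul, mul_one]

lemma IsInvariant.mul_pureState {B : Op n d} (hB : IsInvariant B) (w : Fin n → Fin d)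
    (U : Unitaries d) :
    B * pureState w U = tensorPower n (U : Matrix (Fin d) (Fin d) ℂ) * (B * basisProj w) *
      (tensorPower n (U : Matrix (Fin d) (Fin d) ℂ))ᴴ := by
  simp only [pureState, ← mul_assoc, hB U]

/-- Conjugation by U^{⊗n} passes through `B` and cancels under the trace, which removes all
dependence on `q`. -/
lemma IsInvariant.trace_mul_ensembleState {B : Op n d} (hB : IsInvariant B)
    (q : ProbabilityMeasure (Unitaries d)) (w : Fin n → Fin d) :
    (B * ensembleState q w).trace = B w w := by
  have h : ∀ U : Unitaries d, (B * pureState w U).trace = B w w := fun U => by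
    rw [hB.mul_pureState, Matrix.trace_mul_cycle, tensorPower_unitary_conjTranspose_mul, one_mul,
      trace_mul_basisProj]
  simp [QSI.trace_mul_ensembleState, h]

lemma isInvariant_one : IsInvariant (1 : Op n d) := fun U => by simp

lemma trace_ensembleState (q : ProbabilityMeasure (Unitaries d)) (w : Fin n → Fin d) :
    (ensembleState q w).trace = 1 := by
  simpa using isInvariant_one.trace_mul_ensembleState q w

/-- An eigenvector of `B` is carried by U^{⊗n} to an eigenvector with the same eigenvalue; this
takes the place of Schur's lemma. -/
lemma IsInvariant.mul_ensembleState {B : Op n d} (hB : IsInvariant B) {β : ℂ}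
    {w : Fin n → Fin d} (hw : B * basisProj w = β • basisProj w)
    (q : ProbabilityMeasure (Unitaries d)) :
    B * ensembleState q w = β • ensembleState q w := by
  ext a b
  have h := mul_ensembleState_mul_apply q w B 1 a b
  have hU : ∀ U : Unitaries d, B * pureState w U = β • pureState w U := fun U => by
    rw [hB.mul_pureState, hw]
    simp [pureState]
  simp only [mul_one, hU] at h
  rw [h]
  simp only [Matrix.smul_apply, smul_eq_mul, integral_const_mul, ensembleState_apply]

open scoped MatrixOrder in
lemma trace_mul_nonneg {m : Type*} [Fintype m] [DecidableEq m] {A B : Matrix m m ℂ}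
    (hA : A.PosSemidef) (hB : B.PosSemidef) : 0 ≤ (A * B).trace := by
  obtain ⟨C, rfl⟩ := CStarAlgebra.nonneg_iff_eq_star_mul_self.mp hA.nonneg
  rw [Matrix.star_eq_conjTranspose, mul_assoc, Matrix.trace_mul_comm]
  exact (hB.mul_mul_conjTranspose_same C).trace_nonneg

lemma isHermitian_ensembleState (q : ProbabilityMeasure (Unitaries d)) (w : Fin n → Fin d) :
    (ensembleState q w).IsHermitian := by
  ext a b
  rw [Matrix.conjTranspose_apply, ensembleState_apply, ensembleState_apply]
  have h := integral_conj (μ := (q : Measure (Unitaries d))) (f := fun U => pureState w U b a)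
  refine h.symm.trans (integral_congr_ae (Filter.Eventually.of_forall fun U => ?_))
  exact (posSemidef_pureState w U).1.apply a b

lemma trace_mul_ensembleState_nonneg {E : Op n d} (hE : E.PosSemidef)
    (q : ProbabilityMeasure (Unitaries d)) (w : Fin n → Fin d) :
    0 ≤ (E * ensembleState q w).trace := by
  rw [QSI.trace_mul_ensembleState]
  exact integral_nonneg fun U => trace_mul_nonneg hE (posSemidef_pureState w U)

lemma posSemidef_ensembleState (q : ProbabilityMeasure (Unitaries d)) (w : Fin n → Fin d) :
    (ensembleState q w).PosSemidef := by
  refine Matrix.PosSemidef.of_dotProduct_mulVec_nonneg (isHermitian_ensembleState q w) fun x => ?_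
  -- The quadratic form at `x` is the trace against the rank-one operator x x†.
  have h := trace_mul_ensembleState_nonneg (posSemidef_vecMulVec_self_star x) q w
  rwa [Matrix.trace_mul_comm, Matrix.mul_vecMulVec, Matrix.trace_vecMulVec, dotProduct_comm] at h

end Ensemble

/-! ### Haar-random unitaries -/

section Haar

variable {n d : ℕ}

instance instIsMulLeftInvariantHaar :
    (haar d : Measure (Unitaries d)).IsMulLeftInvariant :=
  inferInstanceAs (Measure.haarMeasure
    (⊤ : TopologicalSpace.PositiveCompacts (Unitaries d))).IsMulLeftInvariant

lemma pureState_mul (w : Fin n → Fin d) (V U : Unitaries d) :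
    pureState w (V * U) = tensorPower n (V : Matrix (Fin d) (Fin d) ℂ) * pureState w U *
      (tensorPower n (V : Matrix (Fin d) (Fin d) ℂ))ᴴ := by
  simp only [pureState, Submonoid.coe_mul, tensorPower_mul, Matrix.conjTranspose_mul, mul_assoc]

lemma isInvariant_ensembleState_haar (w : Fin n → Fin d) :
    IsInvariant (ensembleState (haar d) w) := by
  intro V
  have h : tensorPower n (V : Matrix (Fin d) (Fin d) ℂ) * ensembleState (haar d) w *
      (tensorPower n (V : Matrix (Fin d) (Fin d) ℂ))ᴴ = ensembleState (haar d) w := by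
    ext a b
    rw [mul_ensembleState_mul_apply]
    simp only [← pureState_mul]
    exact integral_mul_left_eq_self (fun U => pureState w U a b) V
  conv_rhs => rw [← h]
  rw [mul_assoc _ _ (tensorPower n (V : Matrix (Fin d) (Fin d) ℂ)),
    tensorPower_unitary_conjTranspose_mul, mul_one]

/-- An invariant operator preserves the type of a word. -/
lemma IsInvariant.apply_eq_zero {B : Op n d} (hB : IsInvariant B) {a b : Fin n → Fin d}
    (j : Fin d) (hj : (Finset.univ.filter fun i => a i = j).card ≠
      (Finset.univ.filter fun i => b i = j).card) : B a b = 0 := by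
  -- Letter counts range over 0, …, n, so order n + 1 is what makes the powers of ζ at distinct
  -- counts distinct. The diagonal unitary with ζ at `j` then separates the counts.
  have hζ := Complex.isPrimitiveRoot_exp (n + 1) n.succ_ne_zero
  set ζ := Complex.exp (2 * Real.pi * Complex.I / ((n + 1 : ℕ) : ℂ))
  have hn : star ζ * ζ = 1 := by
    have h1 : ‖ζ‖ = 1 := hζ.norm'_eq_one n.succ_ne_zero
    rw [Complex.star_def, Complex.conj_mul', h1]
    simp
  have hD : Matrix.diagonal (fun k => if k = j then ζ else 1) ∈ Matrix.unitaryGroup (Fin d) ℂ := by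
    rw [Matrix.mem_unitaryGroup_iff', Matrix.star_eq_conjTranspose, Matrix.diagonal_conjTranspose,
      Matrix.diagonal_mul_diagonal, ← Matrix.diagonal_one]
    congr 1
    ext k
    by_cases hk : k = j
    · simpa [hk] using hn
    · simp [hk]
  have h := congrFun (congrFun (hB ⟨_, hD⟩) a) b
  simp only [tensorPower_diagonal, Matrix.diagonal_mul, Matrix.mul_diagonal] at h
  simp only [Finset.prod_ite, Finset.prod_const, one_pow, mul_one] at h
  rw [mul_comm, ← sub_eq_zero, ← mul_sub] at h
  refine (mul_eq_zero.mp h).resolve_right fun h0 => hj ?_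
  have hle : ∀ c : Fin n → Fin d, (Finset.univ.filter fun i => c i = j).card < n + 1 := fun c =>
    Nat.lt_succ_of_le ((Finset.card_filter_le _ _).trans_eq (by simp))
  exact hζ.pow_inj (hle a) (hle b) (sub_eq_zero.mp h0)

/-- A constant word is the only word with its letter counts. -/
lemma IsInvariant.mul_basisProj_const {B : Op n d} (hB : IsInvariant B) (j : Fin d) :
    B * basisProj (fun _ => j) = B (fun _ => j) (fun _ => j) • basisProj (fun _ => j) := by
  ext a b
  rw [mul_basisProj_apply, Matrix.smul_apply, basisProj, Matrix.single_apply]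
  by_cases ha : a = fun _ => j
  · subst ha
    by_cases hb : b = fun _ => j <;> simp [hb, eq_comm]
  · have h0 : B a (fun _ => j) = 0 := by
      refine hB.apply_eq_zero j fun hc => ha (funext fun i => ?_)
      have hu : (Finset.univ.filter fun i => a i = j) = Finset.univ :=
        Finset.eq_univ_of_card _ (by simpa using hc)
      simpa using hu.ge (Finset.mem_univ i)
    simp [h0, Ne.symm ha]

end Haar

/-! ### The permutation test -/

section PermutationTest

variable {n d : ℕ}

lemma permOp_mul (π σ : Equiv.Perm (Fin n)) :
    permOp d π * permOp d σ = permOp d (π * σ) := by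
  ext a b
  simp only [permOp, Matrix.mul_apply, Matrix.of_apply, _root_.mul_inv_rev, Equiv.Perm.coe_mul, mul_ite,
    mul_one, mul_zero, Finset.sum_ite_eq', Finset.mem_univ, if_true, Function.comp_assoc]

lemma permOp_conjTranspose (π : Equiv.Perm (Fin n)) : (permOp d π)ᴴ = permOp d π⁻¹ := by
  ext a b
  have h : b = a ∘ (π⁻¹ : Equiv.Perm (Fin n)) ↔ a = b ∘ (π⁻¹⁻¹ : Equiv.Perm (Fin n)) := by
    constructor <;> rintro rfl <;> ext i <;> simp
  simp only [permOp, Matrix.conjTranspose_apply, Matrix.of_apply, h]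
  split_ifs <;> simp

lemma isInvariant_permOp (π : Equiv.Perm (Fin n)) : IsInvariant (permOp d π) := by
  intro U
  ext a b
  have h : ∀ c : Fin n → Fin d, a = c ∘ (π⁻¹ : Equiv.Perm (Fin n)) ↔ c = a ∘ π := fun c => by
    constructor <;> rintro rfl <;> ext i <;> simp
  simp only [permOp, Matrix.mul_apply, Matrix.of_apply, h, tensorPower, mul_ite, mul_one,
    mul_zero, ite_mul, one_mul, zero_mul, Finset.sum_ite_eq', Finset.mem_univ, if_true]
  rw [← Equiv.prod_comp π]
  simp

lemma isInvariant_symProj : IsInvariant (symProj n d) := by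
  intro U
  simp only [symProj, Matrix.mul_smul, Matrix.smul_mul, Matrix.mul_sum, Matrix.sum_mul,
    isInvariant_permOp _ U]

lemma permOp_mul_symProj (σ : Equiv.Perm (Fin n)) :
    permOp d σ * symProj n d = symProj n d := by
  simp only [symProj, Matrix.mul_smul, Matrix.mul_sum, permOp_mul]
  rw [← Equiv.sum_comp (Equiv.mulLeft σ) (permOp d)]
  rfl

lemma symProj_mul_self : symProj n d * symProj n d = symProj n d := by
  conv_lhs => enter [1]; rw [symProj]
  simp only [Matrix.smul_mul, Matrix.sum_mul, permOp_mul_symProj, Finset.sum_const,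
    Finset.card_univ, Fintype.card_perm, Fintype.card_fin]
  rw [← Nat.cast_smul_eq_nsmul ℂ, smul_smul, inv_mul_cancel₀ (by positivity), one_smul]

lemma isHermitian_symProj : (symProj n d).IsHermitian := by
  rw [Matrix.IsHermitian, symProj, Matrix.conjTranspose_smul, Matrix.conjTranspose_sum]
  simp only [permOp_conjTranspose]
  rw [← Equiv.sum_comp (Equiv.inv (Equiv.Perm (Fin n))) (permOp d)]
  simp

lemma posSemidef_of_isHermitian_of_mul_self {m : Type*} [Fintype m] {Q : Matrix m m ℂ}
    (hQ : Q.IsHermitian) (hQQ : Q * Q = Q) : Q.PosSemidef := by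
  rw [← hQQ]
  conv => enter [1, 1]; rw [← hQ.eq]
  exact posSemidef_conjTranspose_mul_self Q

lemma isPOVM_symProj : IsPOVM (symProj n d) (1 - symProj n d) where
  posSemidef_equal := posSemidef_of_isHermitian_of_mul_self isHermitian_symProj symProj_mul_self
  posSemidef_unequal := by
    refine posSemidef_of_isHermitian_of_mul_self (isHermitian_one.sub isHermitian_symProj) ?_
    rw [mul_sub, sub_mul, sub_mul, symProj_mul_self]
    simp
  sum_eq_one := by simp

/-- The entry is the fraction of permutations that fix `w`, and the stabilizer is a product of
symmetric groups, one per letter. -/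
lemma symProj_apply_self (w : Fin n → Fin d) :
    symProj n d w w = (n.factorial : ℂ)⁻¹ *
      ∏ j, ((Finset.univ.filter fun i => w i = j).card.factorial : ℂ) := by
  have hw : ∀ π : Equiv.Perm (Fin n),
      w = w ∘ (π⁻¹ : Equiv.Perm (Fin n)) ↔ w ∘ π = w := fun π => by
    constructor
    · intro h
      nth_rw 1 [h]
      ext i
      simp
    · intro h
      nth_rw 2 [← h]
      ext i
      simp
  have hc := DomMulAct.stabilizer_card w
  simp only [Fintype.card_subtype] at hc
  simp only [symProj, permOp, Matrix.smul_apply, Matrix.sum_apply, Matrix.of_apply, hw,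
    Finset.sum_boole, hc, smul_eq_mul, Nat.cast_prod]

end PermutationTest

/-! ### Types of the two input words -/

section Words

variable {n h d : ℕ}

lemma card_filter_unequalWord_one (hd : 2 ≤ d) (hn : h ≤ n) :
    (Finset.univ.filter fun i => unequalWord n h d hd i = ⟨1, by omega⟩).card = h := by
  have h1 : (Finset.univ.filter fun i => unequalWord n h d hd i = ⟨1, by omega⟩) =
      Finset.univ.filter fun i : Fin n => ¬ (i : ℕ) < n - h := by
    ext i
    simp [unequalWord, Fin.ext_iff]
  have h2 := Finset.card_filter_add_card_filter_not (s := (Finset.univ : Finset (Fin n)))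
    fun i => (i : ℕ) < n - h
  have h3 := Fin.card_filter_val_lt (n := n) (m := n - h)
  rw [Finset.card_univ, Fintype.card_fin] at h2
  rw [h1]
  omega

lemma card_filter_unequalWord_zero (hd : 2 ≤ d) (hn : h ≤ n) :
    (Finset.univ.filter fun i => unequalWord n h d hd i = ⟨0, by omega⟩).card = n - h := by
  have h1 : (Finset.univ.filter fun i => unequalWord n h d hd i = ⟨0, by omega⟩) =
      Finset.univ.filter fun i : Fin n => (i : ℕ) < n - h := by
    ext i
    simp [unequalWord, Fin.ext_iff, Nat.lt_sub_iff_add_lt]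
  rw [h1, Fin.card_filter_val_lt]
  omega

lemma card_filter_unequalWord_of_ne (hd : 2 ≤ d) {j : Fin d} (h0 : j ≠ ⟨0, by omega⟩)
    (h1 : j ≠ ⟨1, by omega⟩) :
    (Finset.univ.filter fun i => unequalWord n h d hd i = j).card = 0 := by
  rw [Finset.card_eq_zero, Finset.filter_eq_empty_iff]
  intro i _
  unfold unequalWord
  split_ifs
  exacts [Ne.symm h0, Ne.symm h1]

lemma symProj_unequalWord (hd : 2 ≤ d) (hn : h ≤ n) :
    symProj n d (unequalWord n h d hd) (unequalWord n h d hd) = (n.choose h : ℂ)⁻¹ := by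
  rw [symProj_apply_self, Fintype.prod_eq_mul (⟨0, by omega⟩ : Fin d) ⟨1, by omega⟩ (by simp),
    card_filter_unequalWord_one hd hn, card_filter_unequalWord_zero hd hn]
  · rw [← Nat.choose_mul_factorial_mul_factorial hn]
    push_cast
    field_simp [Nat.factorial_ne_zero, (Nat.choose_pos hn).ne']
  · rintro j ⟨h0, h1⟩
    rw [card_filter_unequalWord_of_ne hd h0 h1]
    simp

lemma symProj_const (j : Fin d) : symProj n d (fun _ => j) (fun _ => j) = 1 := by
  have h : ∀ π : Equiv.Perm (Fin n), permOp d π (fun _ => j) (fun _ => j) = 1 := fun π => by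
    simp [permOp, Function.comp_def]
  simp [symProj, Matrix.sum_apply, h, Fintype.card_perm, Nat.factorial_ne_zero]

/-- The words of type `(n - h, h)` are counted by the `h`-subsets of the positions. -/
lemma card_words_of_type (hd : 2 ≤ d) (hn : h ≤ n) :
    (Finset.univ.filter fun b : Fin n → Fin d => ∀ j,
      (Finset.univ.filter fun i => b i = j).card =
        (Finset.univ.filter fun i => unequalWord n h d hd i = j).card).card = n.choose h := by
  have hcard : (Finset.powersetCard h (Finset.univ : Finset (Fin n))).card = n.choose h := by
    simp
  rw [← hcard]
  refine Finset.card_bij' (fun b _ => Finset.univ.filter fun i => b i = ⟨1, by omega⟩)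
    (fun s _ i => if i ∈ s then ⟨1, by omega⟩ else ⟨0, by omega⟩) ?_ ?_ ?_ ?_
  · intro b hb
    rw [Finset.mem_filter] at hb
    rw [Finset.mem_powersetCard_univ, hb.2, card_filter_unequalWord_one hd hn]
  · intro s hs
    rw [Finset.mem_powersetCard_univ] at hs
    rw [Finset.mem_filter]
    refine ⟨Finset.mem_univ _, fun j => ?_⟩
    by_cases h1 : j = ⟨1, by omega⟩
    · subst h1
      rw [card_filter_unequalWord_one hd hn, ← hs]
      congr 1
      ext i
      simp
    by_cases h0 : j = ⟨0, by omega⟩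
    · subst h0
      have hs' := Finset.card_compl s
      rw [Fintype.card_fin, hs] at hs'
      rw [card_filter_unequalWord_zero hd hn, ← hs']
      congr 1
      ext i
      simp
    · rw [card_filter_unequalWord_of_ne hd h0 h1, Finset.card_eq_zero,
        Finset.filter_eq_empty_iff]
      intro i _
      dsimp only
      split_ifs
      exacts [Ne.symm h1, Ne.symm h0]
  · intro b hb
    rw [Finset.mem_filter] at hb
    ext1 i
    by_cases h1 : b i = ⟨1, by omega⟩
    · simp [h1]
    by_cases h0 : b i = ⟨0, by omega⟩
    · simp [h0]
    -- A third letter would have count zero and yet occur at position `i`.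
    · have := hb.2 (b i)
      rw [card_filter_unequalWord_of_ne hd h0 h1, Finset.card_eq_zero,
        Finset.filter_eq_empty_iff] at this
      exact absurd rfl (this (Finset.mem_univ i))
  · intro s hs
    ext i
    simp

lemma prod_comp_eq_of_type {a b : Fin n → Fin d}
    (hab : ∀ j, (Finset.univ.filter fun i => a i = j).card =
      (Finset.univ.filter fun i => b i = j).card) (f : Fin d → ℂ) :
    ∏ i, f (a i) = ∏ i, f (b i) := by
  have key : ∀ c : Fin n → Fin d,
      ∏ i, f (c i) = ∏ j, f j ^ (Finset.univ.filter fun i => c i = j).card := fun c => by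
    rw [← Finset.prod_fiberwise_of_maps_to (t := Finset.univ) (g := c) (by simp)]
    refine Finset.prod_congr rfl fun j _ => ?_
    rw [Finset.prod_congr rfl (g := fun _ => f j) (by simp +contextual), Finset.prod_const]
  simp only [key, hab]

end Words

/-! ### Comparison of the two Haar-averaged states -/

section Comparison

variable {n h d : ℕ}

lemma exists_unitary_apply_ne_zero (hd : 2 ≤ d) :
    ∃ V : Unitaries d, (V : Matrix (Fin d) (Fin d) ℂ) ⟨0, by omega⟩ ⟨0, by omega⟩ ≠ 0 ∧
      (V : Matrix (Fin d) (Fin d) ℂ) ⟨1, by omega⟩ ⟨0, by omega⟩ ≠ 0 := by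
  -- The Householder reflection along (1, 2, 0, …) has entries 3/5 and -4/5 at the two required
  -- places; along (1, 1, 0, …) the first would vanish.
  set u : Fin d → ℂ := Pi.single ⟨0, by omega⟩ 1 + Pi.single ⟨1, by omega⟩ 2 with hu
  have huu : u ⬝ᵥ u = 5 := by
    simp [hu]
    norm_num
  have hstar : star u = u := by
    ext i
    simp only [hu, Pi.star_apply, Pi.add_apply, star_add, Pi.single_apply]
    split_ifs <;> simp
  have hV : (1 - (2 / 5 : ℂ) • vecMulVec u u : Matrix (Fin d) (Fin d) ℂ) ∈
      Matrix.unitaryGroup (Fin d) ℂ := by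
    rw [Matrix.mem_unitaryGroup_iff', Matrix.star_eq_conjTranspose, Matrix.conjTranspose_sub,
      Matrix.conjTranspose_smul, Matrix.conjTranspose_vecMulVec, Matrix.conjTranspose_one, hstar]
    have h2 : star (2 / 5 : ℂ) = 2 / 5 := by simp
    have h3 : vecMulVec u u * vecMulVec u u = (5 : ℂ) • vecMulVec u u := by
      rw [Matrix.vecMulVec_mul_vecMulVec, huu, Matrix.vecMulVec_smul]
    simp only [h2, mul_sub, sub_mul, one_mul, mul_one, Matrix.smul_mul, Matrix.mul_smul, h3]
    module
  refine ⟨⟨_, hV⟩, ?_, ?_⟩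
  · simp [hu, vecMulVec_apply]
    norm_num
  · simp [hu, vecMulVec_apply]

lemma IsInvariant.apply_const {B : Op n d} (hB : IsInvariant B) (j : Fin d) {a : Fin n → Fin d}
    (ha : a ≠ fun _ => j) : B a (fun _ => j) = 0 := by
  have h := congrFun (congrFun (hB.mul_basisProj_const j) a) fun _ => j
  rw [mul_basisProj_apply, if_pos rfl] at h
  rw [h, Matrix.smul_apply, basisProj, Matrix.single_apply_of_row_ne ha.symm, smul_zero]

lemma ensembleState_const_apply_of_type (q : ProbabilityMeasure (Unitaries d)) (j : Fin d)
    {w b : Fin n → Fin d}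
    (hb : ∀ k, (Finset.univ.filter fun i => b i = k).card =
      (Finset.univ.filter fun i => w i = k).card) :
    ensembleState q (fun _ => j) w b = ensembleState q (fun _ => j) w w := by
  simp only [ensembleState_apply, pureState_apply, tensorPower, Matrix.of_apply,
    fun U : Unitaries d => prod_comp_eq_of_type hb fun k => (U : Matrix (Fin d) (Fin d) ℂ) k j]

/-- Compare the (w, e) entries of T P and P T, where T = V^{⊗n}. On the left only the index e
survives; on the right only the C(n, h) words with the letter counts of w do, and they contribute
equally. The common factor T_we is nonzero by the choice of V. -/
lemma choose_mul_ensembleState_haar (hd : 2 ≤ d) (hn : h ≤ n) :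
    (n.choose h : ℂ) * ensembleState (haar d) (equalWord n d hd)
        (unequalWord n h d hd) (unequalWord n h d hd) =
      ensembleState (haar d) (equalWord n d hd) (equalWord n d hd) (equalWord n d hd) := by
  obtain ⟨V, hV0, hV1⟩ := exists_unitary_apply_ne_zero hd
  set e := equalWord n d hd with he
  set w := unequalWord n h d hd
  set P := ensembleState (haar d) e
  have hP : IsInvariant P := isInvariant_ensembleState_haar e
  set T := tensorPower n (V : Matrix (Fin d) (Fin d) ℂ)
  have hT0 : T w e ≠ 0 := by
    simp only [T, tensorPower, Matrix.of_apply]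
    refine Finset.prod_ne_zero_iff.mpr fun i _ => ?_
    simp only [he, equalWord, w, unequalWord]
    split_ifs
    exacts [hV0, hV1]
  have hTP : (T * P) w e = T w e * P e e := by
    rw [Matrix.mul_apply]
    refine Finset.sum_eq_single e (fun c _ hc => ?_) (by simp)
    rw [show P c e = 0 from hP.apply_const _ hc, mul_zero]
  have hPT : (P * T) w e = n.choose h * (P w w * T w e) := by
    rw [Matrix.mul_apply, ← card_words_of_type hd hn, ← nsmul_eq_mul, ← Finset.sum_const,
      Finset.sum_filter]
    refine Finset.sum_congr rfl fun b _ => ?_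
    split_ifs with hb
    · rw [show P w b = P w w from ensembleState_const_apply_of_type _ _ hb]
      congr 1
      exact prod_comp_eq_of_type hb fun k => (V : Matrix (Fin d) (Fin d) ℂ) k ⟨0, by omega⟩
    · push Not at hb
      obtain ⟨j, hj⟩ := hb
      rw [hP.apply_eq_zero j hj.symm, zero_mul]
  have h := hP V
  have h' := congrFun (congrFun h w) e
  rw [hTP, hPT] at h'
  refine mul_right_cancel₀ hT0 ?_
  rw [mul_assoc, ← h', mul_comm]

/-- The Haar-averaged unequal state dominates `1 / (n choose h)` times the equal one. -/
lemma posSemidef_ensembleState_haar_sub (hd : 2 ≤ d) (hn : h ≤ n) :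
    (ensembleState (haar d) (unequalWord n h d hd) -
      (n.choose h : ℂ)⁻¹ • ensembleState (haar d) (equalWord n d hd)).PosSemidef := by
  set e := equalWord n d hd
  set w := unequalWord n h d hd
  set P := ensembleState (haar d) e
  set A := ensembleState (haar d) w
  have hP : IsInvariant P := isInvariant_ensembleState_haar e
  have hA : IsInvariant A := isInvariant_ensembleState_haar w
  have hPh : Pᴴ = P := isHermitian_ensembleState _ _
  have hAh : Aᴴ = A := isHermitian_ensembleState _ _
  have hPP : P * P = P e e • P := hP.mul_ensembleState (hP.mul_basisProj_const _) _
  have hAP : A * P = A e e • P := hA.mul_ensembleState (hA.mul_basisProj_const _) _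
  have htr : P.trace = 1 := trace_ensembleState _ _
  -- Evaluate Tr(P A) = Tr(A P) twice, using the invariance of P and then A P = A_ee P.
  have hAe : A e e = P w w := by
    have h1 := hP.trace_mul_ensembleState (haar d) w
    rw [Matrix.trace_mul_comm, hAP, Matrix.trace_smul, htr, smul_eq_mul, mul_one] at h1
    exact h1
  have hlam : P e e ≠ 0 := fun h0 => by
    rw [h0, zero_smul] at hPP
    have : P = 0 := by
      rw [← Matrix.conjTranspose_mul_self_eq_zero, hPh, hPP]
    simp [this] at htr
  have hC : (n.choose h : ℂ)⁻¹ = A e e / P e e := by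
    have hc : (n.choose h : ℂ) ≠ 0 := Nat.cast_ne_zero.mpr (Nat.choose_pos hn).ne'
    have := choose_mul_ensembleState_haar (d := d) hd hn
    rw [hAe, eq_div_iff hlam, inv_mul_eq_iff_eq_mul₀ hc]
    exact this.symm
  have hstar : star (A e e) = A e e := by
    rw [← Matrix.conjTranspose_apply, hAh]
  have hPstar : star (P e e) = P e e := by
    rw [← Matrix.conjTranspose_apply, hPh]
  have hPA : P * A = A e e • P := by
    have := congrArg Matrix.conjTranspose hAP
    rwa [Matrix.conjTranspose_mul, Matrix.conjTranspose_smul, hPh, hAh, hstar] at this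
  have hQh : (1 - (P e e)⁻¹ • P)ᴴ = 1 - (P e e)⁻¹ • P := by
    rw [Matrix.conjTranspose_sub, Matrix.conjTranspose_smul, Matrix.conjTranspose_one, hPh,
      star_inv₀, hPstar]
  -- Compress A to the complement of the projection P / P_ee.
  have hPSD := (posSemidef_ensembleState (haar d) w).mul_mul_conjTranspose_same
    (1 - (P e e)⁻¹ • P)
  convert hPSD using 1
  rw [hQh, hC]
  change A - _ = (1 - (P e e)⁻¹ • P) * A * (1 - (P e e)⁻¹ • P)
  simp only [mul_sub, sub_mul, Matrix.smul_mul, Matrix.mul_smul, one_mul, mul_one, hPA, hAP, hPP,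
    smul_smul]
  rw [show (P e e)⁻¹ * ((P e e)⁻¹ * A e e * P e e) = A e e / P e e by field_simp,
    show (P e e)⁻¹ * A e e = A e e / P e e by ring]
  module

end Comparison

/-! ### Success probabilities -/

section Success

variable {n h d : ℕ}

lemma IsPOVM.completeness_nonneg {E F : Op n d} (hEF : IsPOVM E F) (hd : 2 ≤ d)
    (q : ProbabilityMeasure (Unitaries d)) : 0 ≤ completeness hd q E :=
  (Complex.le_def.mp (trace_mul_ensembleState_nonneg hEF.posSemidef_equal q _)).1

lemma IsPOVM.soundness_nonneg {E F : Op n d} (hEF : IsPOVM E F) (hd : 2 ≤ d)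
    (q : ProbabilityMeasure (Unitaries d)) : 0 ≤ soundness hd h q F :=
  (Complex.le_def.mp (trace_mul_ensembleState_nonneg hEF.posSemidef_unequal q _)).1

lemma IsPOVM.avgSuccess_nonneg {E F : Op n d} (hEF : IsPOVM E F) (hd : 2 ≤ d)
    (q : ProbabilityMeasure (Unitaries d)) : 0 ≤ avgSuccess hd h (1 / 2) q E F := by
  have h1 := hEF.completeness_nonneg hd q
  have h2 := hEF.soundness_nonneg (h := h) hd q
  unfold avgSuccess
  linarith

lemma IsPOVM.completeness_le_one {E F : Op n d} (hEF : IsPOVM E F) (hd : 2 ≤ d)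
    (q : ProbabilityMeasure (Unitaries d)) : completeness hd q E ≤ 1 := by
  have hF := (Complex.le_def.mp (trace_mul_ensembleState_nonneg hEF.posSemidef_unequal q
    (equalWord n d hd))).1
  rw [← sub_eq_of_eq_add' hEF.sum_eq_one.symm, sub_mul, Matrix.trace_sub, one_mul,
    trace_ensembleState] at hF
  simpa [completeness] using hF

lemma IsPOVM.soundness_haar_le {E F : Op n d} (hEF : IsPOVM E F) (hd : 2 ≤ d) (hn : h ≤ n) :
    soundness hd h (haar d) F ≤ 1 - (n.choose h : ℝ)⁻¹ * completeness hd (haar d) E := by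
  have hE := (Complex.le_def.mp (trace_mul_nonneg hEF.posSemidef_equal
    (posSemidef_ensembleState_haar_sub hd hn))).1
  rw [mul_sub, Matrix.trace_sub, Matrix.mul_smul, Matrix.trace_smul, smul_eq_mul,
    show (n.choose h : ℂ)⁻¹ = ((n.choose h : ℝ)⁻¹ : ℝ) by push_cast; rfl, Complex.sub_re,
    Complex.re_ofReal_mul, Complex.zero_re] at hE
  rw [soundness, ← sub_eq_of_eq_add' hEF.sum_eq_one.symm, sub_mul, Matrix.trace_sub, one_mul,
    trace_ensembleState, Complex.sub_re, Complex.one_re, completeness]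
  linarith

lemma IsPOVM.avgSuccess_haar_le {E F : Op n d} (hEF : IsPOVM E F) (hd : 2 ≤ d) (hn : h ≤ n) :
    avgSuccess hd h (1 / 2) (haar d) E F ≤ 1 - 1 / (2 * (n.choose h : ℝ)) := by
  have h1 := hEF.soundness_haar_le hd hn
  have h2 := hEF.completeness_le_one hd (haar d)
  have h3 : (n.choose h : ℝ)⁻¹ ≤ 1 :=
    inv_le_one_of_one_le₀ (by exact_mod_cast Nat.choose_pos hn)
  -- Expanding (1 - 1/C)(1 - c) ≥ 0, with c the completeness, gives 1 + c(1 - 1/C) ≤ 2 - 1/C.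
  have h4 := mul_nonneg (sub_nonneg.mpr h3) (sub_nonneg.mpr h2)
  rw [avgSuccess, one_div (2 * _), mul_inv]
  linarith

lemma completeness_symProj (hd : 2 ≤ d) (q : ProbabilityMeasure (Unitaries d)) :
    completeness hd q (symProj n d) = 1 := by
  rw [completeness, isInvariant_symProj.trace_mul_ensembleState]
  exact congrArg Complex.re (symProj_const _)

lemma soundness_symProj (hd : 2 ≤ d) (hn : h ≤ n) (q : ProbabilityMeasure (Unitaries d)) :
    soundness hd h q (1 - symProj n d) = 1 - 1 / (n.choose h : ℝ) := by
  rw [soundness, isInvariant_symProj.one_sub.trace_mul_ensembleState, Matrix.sub_apply,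
    Matrix.one_apply_eq, symProj_unequalWord hd hn,
    show (n.choose h : ℂ)⁻¹ = ((n.choose h : ℝ)⁻¹ : ℝ) by push_cast; rfl, Complex.sub_re,
    Complex.one_re, Complex.ofReal_re, one_div]

lemma avgSuccess_symProj (hd : 2 ≤ d) (hn : h ≤ n) (q : ProbabilityMeasure (Unitaries d)) :
    avgSuccess hd h (1 / 2) q (symProj n d) (1 - symProj n d) =
      1 - 1 / (2 * (n.choose h : ℝ)) := by
  rw [avgSuccess, completeness_symProj, soundness_symProj hd hn, one_div (2 * _), mul_inv]
  ring

lemma worstCaseSuccess_symProj (hd : 2 ≤ d) (hn : h ≤ n) :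
    worstCaseSuccess hd h (1 / 2) (symProj n d) (1 - symProj n d) =
      1 - 1 / (2 * (n.choose h : ℝ)) := by
  -- A real infimum over an empty family would default to 0.
  have : Nonempty (ProbabilityMeasure (Unitaries d)) := ⟨haar d⟩
  simp only [worstCaseSuccess, avgSuccess_symProj hd hn, ciInf_const]

lemma IsPOVM.worstCaseSuccess_le {E F : Op n d} (hEF : IsPOVM E F) (hd : 2 ≤ d)
    (q : ProbabilityMeasure (Unitaries d)) :
    worstCaseSuccess hd h (1 / 2) E F ≤ avgSuccess hd h (1 / 2) q E F :=
  -- The lower bound 0 ensures that the real infimum is a genuine one.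
  ciInf_le ⟨0, by rintro _ ⟨q, rfl⟩; exact hEF.avgSuccess_nonneg hd q⟩ q

end Success

end QSI

theorem theorem4p2 (n h d : ℕ) (hd : 2 ≤ d) (h_pos : 1 ≤ h) (h_le : 2 * h ≤ n) :
    -- the permutation test is a measurement
    QSI.IsPOVM (QSI.symProj n d) (1 - QSI.symProj n d) ∧
    -- it is optimal for Haar-random inputs, among all measurements
    (∀ E F : QSI.Op n d, QSI.IsPOVM E F →
      QSI.avgSuccess hd h (1 / 2) (QSI.haar d) E F ≤
        QSI.avgSuccess hd h (1 / 2) (QSI.haar d) (QSI.symProj n d) (1 - QSI.symProj n d)) ∧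
    -- it is optimal for an unknown unitary (adversarially distributed), among all measurements
    (∀ E F : QSI.Op n d, QSI.IsPOVM E F →
      QSI.worstCaseSuccess hd h (1 / 2) E F ≤
        QSI.worstCaseSuccess hd h (1 / 2) (QSI.symProj n d) (1 - QSI.symProj n d)) ∧
    -- its success probabilities, for the Haar measure and every other distribution of the unitary
    (∀ q : MeasureTheory.ProbabilityMeasure (QSI.Unitaries d),
      QSI.avgSuccess hd h (1 / 2) q (QSI.symProj n d) (1 - QSI.symProj n d) =
          1 - 1 / (2 * (n.choose h : ℝ)) ∧
        QSI.completeness hd q (QSI.symProj n d) = 1 ∧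
        QSI.soundness hd h q (1 - QSI.symProj n d) = 1 - 1 / (n.choose h : ℝ)) := by
  have hn : h ≤ n := by omega
  refine ⟨QSI.isPOVM_symProj, fun E F hEF => ?_, fun E F hEF => ?_, fun q =>
    ⟨QSI.avgSuccess_symProj hd hn q, QSI.completeness_symProj hd q,
      QSI.soundness_symProj hd hn q⟩⟩
  · rw [QSI.avgSuccess_symProj hd hn]
    exact hEF.avgSuccess_haar_le hd hn
  · rw [QSI.worstCaseSuccess_symProj hd hn]
    exact (hEF.worstCaseSuccess_le hd (QSI.haar d)).trans (hEF.avgSuccess_haar_le hd hn)
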